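/- Let $(X,d_X)$ and $(Y,d_Y)$ be Hadamard spaces, i.e. complete $\mathrm{CAT}(0)$ spaces. Let $f\colon X\times Y\to\mathbb R$ be a function such that (i) $f(\,\cdot\,,y)$ is upper semicontinuous and concave on $X$ for each $y\in Y$; (ii) $f(x,\,\cdot\,)$ is lower semicontinuous and convex on $Y$ for each $x\in X$. Here a real function $h$ on a Hadamard space is called convex if $h(\gamma(t))\le (1-t)h(\gamma(0))+t\,h(\gamma(1))$ for every constant-speed geodesic $\gamma$ parametrized by $[0,1]$ and every $t\in[0,1]$, and concave if $-h$ is convex. Then for every $(a,b)\in X\times Y$ the function $g\colon X\times Y\to\mathbb R$ defined by $$g(x,y)=f(x,y)-\tfrac12 d_X(x,a)^2+\tfrac12 d_Y(y,b)^2$$ has a unique saddle point, i.e. there exists a unique $(\hat a,\hat b)\in X\times Y$ such that $$g(x,\hat b)\le g(\hat a,\hat b)\le g(\hat a,y)\qquad\text{for all }(x,y)\in X\times Y.$$ -/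

import Mathlib

open scoped unitInterval

/-- `γ : [0,1] → X` is a normalized geodesic from `x` to `y`:
`γ 0 = x`, `γ 1 = y` and `d(γ s, γ t) = d(x, y) |s - t|`. -/
structure IsNormalizedGeodesic {X : Type*} [MetricSpace X] (γ : I → X) (x y : X) : Prop where
  map_zero : γ 0 = x
  map_one : γ 1 = y
  dist_map : ∀ s t : I, dist (γ s) (γ t) = dist x y * |(s : ℝ) - (t : ℝ)|

/-- A `CAT(0)` space: a geodesic metric space in which every geodesic triangle is at least as thin
as its comparison triangles in the Euclidean plane. -/
class CATZeroSpace (X : Type*) [MetricSpace X] : Prop where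
  exists_geodesic : ∀ x y : X, ∃ γ : I → X, IsNormalizedGeodesic γ x y
  dist_le_comparison : ∀ (x y z : X) (γ₁ γ₂ : I → X) (x' y' z' : EuclideanSpace ℝ (Fin 2)),
    IsNormalizedGeodesic γ₁ x y → IsNormalizedGeodesic γ₂ x z →
    dist x y = ‖x' - y'‖ → dist y z = ‖y' - z'‖ → dist z x = ‖z' - x'‖ →
    ∀ α β : I, dist (γ₁ α) (γ₂ β) ≤
      ‖((1 - (α : ℝ)) • x' + (α : ℝ) • y') - ((1 - (β : ℝ)) • x' + (β : ℝ) • z')‖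

/-- A Hadamard space is a complete `CAT(0)` space. -/
class HadamardSpace (X : Type*) [MetricSpace X] : Prop extends CATZeroSpace X, CompleteSpace X

/-- (Geodesic) convexity of a real function: `f ((1 - α) x ⊕ α y) ≤ (1 - α) f x + α f y`, where
`(1 - α) x ⊕ α y = γ α` for the normalized geodesic `γ` from `x` to `y`
(which is unique in a `CAT(0)` space). -/
def GeodesicConvex {X : Type*} [MetricSpace X] (f : X → ℝ) : Prop :=
  ∀ (x y : X) (γ : I → X), IsNormalizedGeodesic γ x y →
    ∀ α : I, f (γ α) ≤ (1 - (α : ℝ)) * f x + (α : ℝ) * f y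

/-- (Geodesic) concavity of a real function: `-f` is convex. -/
def GeodesicConcave {X : Type*} [MetricSpace X] (f : X → ℝ) : Prop :=
  GeodesicConvex (fun x => -f x)

/-- `p = (x₀, y₀)` is a saddle point of `g` (maximizing in the first variable, minimizing in the
second): `g (x, y₀) ≤ g (x₀, y₀) ≤ g (x₀, y)` for all `x` and `y`. -/
def IsSaddlePoint {X Y : Type*} (g : X × Y → ℝ) (p : X × Y) : Prop :=
  ∀ (x : X) (y : Y), g (x, p.2) ≤ g p ∧ g p ≤ g (p.1, y)

/-!
Adding half a squared distance to a convex function on a `CAT(0)` space makes it strongly convex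
(`GeodesicConvex.add_half_sq_dist`), because squared distances satisfy the inequality
`dist_sq_le_of_isNormalizedGeodesic`, read off from a Euclidean comparison triangle. On a Hadamard
space a strongly convex lower semicontinuous function is bounded below, its minimizing sequences
are Cauchy, and it attains its minimum with quadratic growth
(`GeodesicStronglyConvex.exists_quadratic_growth`).

Let `g` be the regularized function and `φ x = min_y g (x, y)`. As a minimum of strongly concave
upper semicontinuous functions, `-φ` is strongly convex and lower semicontinuous, so `φ` has a
maximizer `x₀`; let `y₀` minimize `g (x₀, ·)`. Moving from `x₀` towards `x` to `x_t`, with `y_t`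
the minimizer of `g (x_t, ·)`, concavity of `g (·, y_t)` and maximality of `φ x₀` give
`g (x, y_t) ≤ φ x₀`, while quadratic growth of `g (x₀, ·)` gives `y_t → y₀` as `t → 0`. Lower
semicontinuity of `g (x, ·)` then yields `g (x, y₀) ≤ φ x₀ = g (x₀, y₀)`, with no joint
semicontinuity needed. Uniqueness is quadratic growth again.
-/

open Filter Topology

/-- Strong geodesic convexity, normalized so that `y ↦ dist y b ^ 2 / 2` has modulus exactly one
in Euclidean space. -/
def GeodesicStronglyConvex {X : Type*} [MetricSpace X] (h : X → ℝ) : Prop :=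
  ∀ (x y : X) (γ : I → X), IsNormalizedGeodesic γ x y → ∀ t : I,
    h (γ t) ≤ (1 - (t : ℝ)) * h x + t * h y - (1 / 2) * (t * (1 - t)) * dist x y ^ 2

/-! ### Squared distances in `CAT(0)` spaces -/

/-- Existence of Euclidean comparison triangles, with `x'` placed at the origin and `y'` on the
first coordinate axis. -/
theorem exists_comparison_triangle {X : Type*} [MetricSpace X] (x y z : X) :
    ∃ x' y' z' : EuclideanSpace ℝ (Fin 2),
      dist x y = ‖x' - y'‖ ∧ dist y z = ‖y' - z'‖ ∧ dist z x = ‖z' - x'‖ := by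
  have norm_eq : ∀ p q : ℝ, ‖(!₂[p, q] : EuclideanSpace ℝ (Fin 2))‖ = √(p ^ 2 + q ^ 2) := by
    intro p q
    simp [EuclideanSpace.norm_eq, Fin.sum_univ_two]
  have hxy := dist_nonneg (x := x) (y := y)
  have hyz := dist_nonneg (x := y) (y := z)
  have hzx := dist_nonneg (x := z) (y := x)
  rcases hxy.eq_or_lt with h0 | h0
  · obtain rfl := dist_eq_zero.1 h0.symm
    refine ⟨0, 0, !₂[dist z x, 0], by simp, ?_, ?_⟩
    · rw [zero_sub, norm_neg, norm_eq, dist_comm]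
      simp [Real.sqrt_sq]
    · rw [sub_zero, norm_eq]
      simp [Real.sqrt_sq]
  · set p := dist x y with hp
    set e := dist y z with he
    set c := dist z x with hc
    have t1 : e ≤ p + c := by
      have := dist_triangle y x z
      rwa [dist_comm y x, dist_comm x z] at this
    have t2 : p ≤ e + c := by
      have := dist_triangle x z y
      rw [dist_comm x z, dist_comm z y] at this
      linarith
    have t3 : c ≤ p + e := by
      have := dist_triangle z y x
      rw [dist_comm z y, dist_comm y x] at this
      linarith
    -- The first coordinate of `z'` is dictated by the law of cosines.
    obtain ⟨u, hu⟩ : ∃ u : ℝ, 2 * p * u = p ^ 2 + c ^ 2 - e ^ 2 :=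
      ⟨(p ^ 2 + c ^ 2 - e ^ 2) / (2 * p), by field_simp⟩
    have h1 : -c ≤ u := by
      have : 0 ≤ 2 * p * (u + c) := by nlinarith
      have := nonneg_of_mul_nonneg_right this (by positivity)
      linarith
    have h2 : u ≤ c := by
      have : 0 ≤ 2 * p * (c - u) := by nlinarith
      have := nonneg_of_mul_nonneg_right this (by positivity)
      linarith
    have h3 : 0 ≤ c ^ 2 - u ^ 2 := by nlinarith
    have h4 := Real.sq_sqrt h3
    refine ⟨0, !₂[p, 0], !₂[u, √(c ^ 2 - u ^ 2)], ?_, ?_, ?_⟩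
    · rw [zero_sub, norm_neg, norm_eq]
      simp [Real.sqrt_sq hxy]
    · have : (!₂[p, 0] - !₂[u, √(c ^ 2 - u ^ 2)] : EuclideanSpace ℝ (Fin 2))
          = !₂[p - u, -√(c ^ 2 - u ^ 2)] := by
        ext i; fin_cases i <;> simp
      rw [this, norm_eq, neg_sq, h4]
      rw [show (p - u) ^ 2 + (c ^ 2 - u ^ 2) = e ^ 2 by linarith, Real.sqrt_sq hyz]
    · rw [sub_zero, norm_eq, h4]
      rw [show u ^ 2 + (c ^ 2 - u ^ 2) = c ^ 2 by ring, Real.sqrt_sq hzx]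

/-- The Bruhat–Tits inequality along a whole geodesic; in Euclidean space it is Stewart's
theorem, with equality. -/
theorem dist_sq_le_of_isNormalizedGeodesic {X : Type*} [MetricSpace X] [CATZeroSpace X]
    {x y : X} {γ : I → X} (hγ : IsNormalizedGeodesic γ x y) (z : X) (t : I) :
    dist (γ t) z ^ 2 ≤ (1 - (t : ℝ)) * dist x z ^ 2 + t * dist y z ^ 2
      - t * (1 - t) * dist x y ^ 2 := by
  obtain ⟨x', y', z', h1, h2, h3⟩ := exists_comparison_triangle x y z
  obtain ⟨δ, hδ⟩ := CATZeroSpace.exists_geodesic x z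
  have h := CATZeroSpace.dist_le_comparison x y z γ δ x' y' z' hγ hδ h1 h2 h3 t 1
  rw [hδ.map_one] at h
  have h' := pow_le_pow_left₀ dist_nonneg h 2
  refine h'.trans (le_of_eq ?_)
  rw [dist_comm x z, h1, h2, h3]
  simp only [EuclideanSpace.norm_sq_eq, Fin.sum_univ_two, Real.norm_eq_abs, sq_abs]
  simp
  ring

theorem GeodesicConvex.add_half_sq_dist {X : Type*} [MetricSpace X] [CATZeroSpace X]
    {h : X → ℝ} (hh : GeodesicConvex h) (b : X) :
    GeodesicStronglyConvex fun y => h y + (1 / 2) * dist y b ^ 2 := by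
  intro x y γ hγ t
  have h1 := hh x y γ hγ t
  have h2 := dist_sq_le_of_isNormalizedGeodesic hγ b t
  simp only
  linarith

theorem LowerSemicontinuous.add_half_sq_dist {X : Type*} [MetricSpace X] {h : X → ℝ}
    (hh : LowerSemicontinuous h) (b : X) :
    LowerSemicontinuous fun y => h y + (1 / 2) * dist y b ^ 2 :=
  hh.add (Continuous.lowerSemicontinuous (by fun_prop))

theorem GeodesicStronglyConvex.add_const {X : Type*} [MetricSpace X] {h : X → ℝ}
    (hh : GeodesicStronglyConvex h) (c : ℝ) : GeodesicStronglyConvex fun x => h x + c := by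
  intro x y γ hγ t
  have := hh x y γ hγ t
  simp only
  linarith

/-! ### Minimizing strongly convex functions -/

theorem GeodesicStronglyConvex.exists_midpoint {X : Type*} [MetricSpace X] [CATZeroSpace X]
    {h : X → ℝ} (hh : GeodesicStronglyConvex h) (x y : X) :
    ∃ m, h m ≤ (h x + h y) / 2 - dist x y ^ 2 / 8 := by
  obtain ⟨γ, hγ⟩ := CATZeroSpace.exists_geodesic x y
  refine ⟨γ ⟨1 / 2, by norm_num, by norm_num⟩, (hh x y γ hγ _).trans (le_of_eq ?_)⟩
  simp only
  ring

/-- Lower semicontinuity bounds `h` below near `b`; along a geodesic leaving that neighbourhood,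
convexity costs at most a linear term, which the quadratic gain of strong convexity absorbs. -/
theorem GeodesicStronglyConvex.bddBelow {X : Type*} [MetricSpace X] [CATZeroSpace X]
    {h : X → ℝ} (hh : GeodesicStronglyConvex h) (hl : LowerSemicontinuous h) :
    BddBelow (Set.range h) := by
  rcases isEmpty_or_nonempty X with _ | ⟨⟨b⟩⟩
  · simp [Set.range_eq_empty]
  obtain ⟨r, hr, hball⟩ := Metric.eventually_nhds_iff.1 (hl b (h b - 1) (by linarith))
  refine ⟨h b - 1 - 4 / r ^ 2, ?_⟩
  rintro _ ⟨y, rfl⟩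
  have hpos : 0 < 4 / r ^ 2 := by positivity
  rcases lt_or_ge (dist y b) r with hy | hy
  · linarith [hball hy]
  rw [dist_comm] at hy
  set d := dist b y with hd
  have hd0 : 0 < d := hr.trans_le hy
  obtain ⟨γ, hγ⟩ := CATZeroSpace.exists_geodesic b y
  obtain ⟨t, ht⟩ : ∃ t : ℝ, t * d = r / 2 := ⟨r / 2 / d, by field_simp⟩
  have ht0 : 0 < t := by
    by_contra! hc
    nlinarith
  have ht1 : t ≤ 1 / 2 := by
    by_contra! hc
    nlinarith
  have hz : dist (γ ⟨t, ht0.le, by linarith⟩) b < r := by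
    have := hγ.dist_map ⟨t, ht0.le, by linarith⟩ 0
    rw [hγ.map_zero] at this
    rw [this]
    simp only [Set.Icc.coe_zero, sub_zero, abs_of_pos ht0, ← hd]
    linarith
  have h1 := hball hz
  have h2 := hh b y γ hγ ⟨t, ht0.le, by linarith⟩
  simp only [← hd] at h2
  have h3 : 0 < t * (h y - h b) + 1 - (1 / 2) * (t * (1 - t)) * d ^ 2 := by linarith
  -- Dividing by `t` turns the constant `1` into `2 * d / r`.
  have h4 : 0 < (h y - h b) + 2 * d / r - (1 / 2) * (1 - t) * d ^ 2 := by
    have e : t * (2 * d / r) = 1 := by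
      rw [show t * (2 * d / r) = 2 * (t * d) / r by ring, ht]
      field_simp
    have : 0 < t * ((h y - h b) + 2 * d / r - (1 / 2) * (1 - t) * d ^ 2) := by
      nlinarith
    exact pos_of_mul_pos_right this ht0.le
  have h5 : (1 / 4) * d ^ 2 ≤ (1 / 2) * (1 - t) * d ^ 2 := by nlinarith [sq_nonneg d]
  have h6 : 0 ≤ (d / 2 - 2 / r) ^ 2 := sq_nonneg _
  have h7 : (d / 2 - 2 / r) ^ 2 = (1 / 4) * d ^ 2 - 2 * d / r + 4 / r ^ 2 := by
    field_simp
    ring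
  linarith

/-- A strongly convex lower semicontinuous function on a Hadamard space attains its minimum, with
quadratic growth away from the minimizer; in particular the minimizer is unique. The constant is
the one given by comparison with midpoints. -/
theorem GeodesicStronglyConvex.exists_quadratic_growth {X : Type*} [MetricSpace X]
    [HadamardSpace X] [Nonempty X] {h : X → ℝ} (hh : GeodesicStronglyConvex h)
    (hl : LowerSemicontinuous h) :
    ∃ m, ∀ y, h m + dist m y ^ 2 / 4 ≤ h y := by
  have hb := hh.bddBelow hl
  have hinf : ∀ y, ⨅ y, h y ≤ h y := fun y => ciInf_le hb y
  have hseq : ∀ n : ℕ, ∃ y, h y < (⨅ y, h y) + 1 / ((n : ℝ) + 1) := fun n =>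
    exists_lt_of_ciInf_lt (lt_add_of_pos_right _ (by positivity))
  choose u hu using hseq
  have hlim : Tendsto (fun n : ℕ => (⨅ y, h y) + 1 / ((n : ℝ) + 1)) atTop (𝓝 (⨅ y, h y)) := by
    simpa using tendsto_const_nhds.add (tendsto_one_div_add_atTop_nhds_zero_nat (𝕜 := ℝ))
  have hcauchy : CauchySeq u := by
    refine cauchySeq_of_le_tendsto_0 (fun N : ℕ => √(8 * (1 / ((N : ℝ) + 1)))) ?_ ?_
    · intro n m N hn hm
      obtain ⟨z, hz⟩ := hh.exists_midpoint (u n) (u m)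
      have h1 : 1 / ((n : ℝ) + 1) ≤ 1 / ((N : ℝ) + 1) := Nat.one_div_le_one_div hn
      have h2 : 1 / ((m : ℝ) + 1) ≤ 1 / ((N : ℝ) + 1) := Nat.one_div_le_one_div hm
      apply Real.le_sqrt_of_sq_le
      linarith [hinf z, hu n, hu m]
    · have := ((tendsto_one_div_add_atTop_nhds_zero_nat (𝕜 := ℝ)).const_mul 8).sqrt
      simpa using this
  obtain ⟨m, hm⟩ := cauchySeq_tendsto_of_complete hcauchy
  have hmin : h m ≤ ⨅ y, h y := by
    refine le_of_forall_lt fun c hc => ?_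
    by_contra! hle
    obtain ⟨c', h1, h2⟩ := exists_between hc
    have e1 := hm.eventually (hl m c' h2)
    have e2 := hlim.eventually (gt_mem_nhds (hle.trans_lt h1))
    obtain ⟨n, hn1, hn2⟩ := (e1.and e2).exists
    linarith [hu n]
  refine ⟨m, fun y => ?_⟩
  obtain ⟨z, hz⟩ := hh.exists_midpoint m y
  linarith [hinf z]

/-! ### Saddle points -/

/-- Minimax for a function which is strongly concave and upper semicontinuous in the first
variable, strongly convex and lower semicontinuous in the second. -/
theorem existsUnique_isSaddlePoint {X Y : Type*} [MetricSpace X] [MetricSpace Y]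
    [HadamardSpace X] [HadamardSpace Y] [Nonempty X] [Nonempty Y] {g : X × Y → ℝ}
    (hx : ∀ y, GeodesicStronglyConvex fun x => -g (x, y))
    (hxl : ∀ y, LowerSemicontinuous fun x => -g (x, y))
    (hy : ∀ x, GeodesicStronglyConvex fun y => g (x, y))
    (hyl : ∀ x, LowerSemicontinuous fun y => g (x, y)) :
    ∃! p, IsSaddlePoint g p := by
  choose η hη using fun x => (hy x).exists_quadratic_growth (hyl x)
  have hmin : ∀ x y, g (x, η x) ≤ g (x, y) := fun x y => by
    linarith [hη x y, sq_nonneg (dist (η x) y)]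
  -- The marginal function `x ↦ g (x, η x) = min_y g (x, y)`, up to sign.
  have hφ : GeodesicStronglyConvex fun x => -g (x, η x) := by
    intro x x' γ hγ t
    have h1 := hx (η (γ t)) x x' γ hγ t
    simp only at h1 ⊢
    have h2 := mul_le_mul_of_nonneg_left (hmin x (η (γ t))) (sub_nonneg.2 t.2.2)
    have h3 := mul_le_mul_of_nonneg_left (hmin x' (η (γ t))) t.2.1
    linarith
  have hφl : LowerSemicontinuous fun x => -g (x, η x) := by
    intro x c hc
    filter_upwards [hxl (η x) x c hc] with x' hx'
    linarith [hmin x' (η x)]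
  obtain ⟨x₀, hx₀⟩ := hφ.exists_quadratic_growth hφl
  have hmax : ∀ x, g (x, η x) ≤ g (x₀, η x₀) := fun x => by
    linarith [hx₀ x, sq_nonneg (dist x₀ x)]
  have hsaddle : ∀ x, g (x, η x₀) ≤ g (x₀, η x₀) := by
    intro x
    obtain ⟨γ, hγ⟩ := CATZeroSpace.exists_geodesic x₀ x
    have hconc : ∀ t : I, (1 - (t : ℝ)) * g (x₀, η (γ t)) + t * g (x, η (γ t))
        ≤ g (x₀, η x₀) := by
      intro t
      have h1 := hx (η (γ t)) x₀ x γ hγ t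
      simp only at h1
      have h2 : 0 ≤ (1 / 2) * ((t : ℝ) * (1 - t)) * dist x₀ x ^ 2 :=
        mul_nonneg (mul_nonneg (by norm_num) (mul_nonneg t.2.1 (sub_nonneg.2 t.2.2)))
          (sq_nonneg _)
      linarith [hmax (γ t)]
    set C := g (x₀, η x₀) - g (x, η x) with hC
    -- The points `γ (1 / (n + 2))` tend to `x₀`, and these parameters stay away from `1`.
    let τ : ℕ → I := fun n => ⟨1 / ((n : ℝ) + 2), by positivity, by
      rw [div_le_one (by positivity)]; linarith [(n.cast_nonneg : (0 : ℝ) ≤ n)]⟩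
    have hτv : ∀ n, (τ n : ℝ) = 1 / ((n : ℝ) + 2) := fun n => rfl
    have hτ0 : ∀ n, 0 < (τ n : ℝ) := fun n => by rw [hτv]; positivity
    have hτ1 : ∀ n, (τ n : ℝ) ≤ 1 / 2 := fun n => by
      rw [hτv]
      exact one_div_le_one_div_of_le two_pos (by linarith [(n.cast_nonneg : (0 : ℝ) ≤ n)])
    have hτ : Tendsto (fun n => (τ n : ℝ)) atTop (𝓝 0) := by
      simp only [hτv, one_div]
      exact tendsto_inv_atTop_zero.comp
        (tendsto_atTop_add_const_right _ _ tendsto_natCast_atTop_atTop)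
    have hle : ∀ n, g (x, η (γ (τ n))) ≤ g (x₀, η x₀) := by
      intro n
      have h1 := mul_le_mul_of_nonneg_left (hmin x₀ (η (γ (τ n)))) (sub_nonneg.2 (τ n).2.2)
      have h2 := hconc (τ n)
      exact le_of_mul_le_mul_left (by linarith) (hτ0 n)
    have hdist : ∀ n, dist (η (γ (τ n))) (η x₀) ≤ √(8 * (τ n * C)) := by
      intro n
      have h1 := mul_le_mul_of_nonneg_left (hη x₀ (η (γ (τ n)))) (sub_nonneg.2 (τ n).2.2)
      have h2 := mul_le_mul_of_nonneg_left (hmin x (η (γ (τ n)))) (τ n).2.1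
      have h3 := hconc (τ n)
      have h4 : (1 / 2) * (dist (η x₀) (η (γ (τ n))) ^ 2 / 4)
          ≤ (1 - (τ n : ℝ)) * (dist (η x₀) (η (γ (τ n))) ^ 2 / 4) :=
        mul_le_mul_of_nonneg_right (by linarith [hτ1 n]) (by positivity)
      rw [dist_comm]
      apply Real.le_sqrt_of_sq_le
      rw [hC]
      linarith
    have hconv : Tendsto (fun n => η (γ (τ n))) atTop (𝓝 (η x₀)) := by
      rw [tendsto_iff_dist_tendsto_zero]
      refine squeeze_zero (fun _ => dist_nonneg) hdist ?_
      simpa using ((hτ.mul_const C).const_mul 8).sqrt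
    refine le_of_forall_lt fun c hc => ?_
    obtain ⟨n, hn⟩ := (hconv.eventually (hyl x (η x₀) c hc)).exists
    exact hn.trans_le (hle n)
  refine ⟨(x₀, η x₀), fun x y => ⟨hsaddle x, hmin x₀ y⟩, ?_⟩
  rintro ⟨x₁, y₁⟩ hp
  -- Both coordinates of a second saddle point attain the extrema that characterize `(x₀, η x₀)`.
  have h1 := (hp x₀ (η x₁)).1
  have h2 := (hp x₀ (η x₁)).2
  have h3 := (hp x₀ (η x₀)).2
  simp only at h1 h2 h3
  have hxeq : x₀ = x₁ := by
    have := hx₀ x₁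
    rw [← dist_eq_zero, ← sq_eq_zero_iff]
    linarith [hmin x₀ y₁, sq_nonneg (dist x₀ x₁)]
  subst hxeq
  have hyeq : η x₀ = y₁ := by
    have := hη x₀ y₁
    rw [← dist_eq_zero, ← sq_eq_zero_iff]
    linarith [sq_nonneg (dist (η x₀) y₁)]
  rw [hyeq]

theorem mainTheorem4 {X Y : Type*} [MetricSpace X] [MetricSpace Y]
    [HadamardSpace X] [HadamardSpace Y] (f : X × Y → ℝ)
    (hf_usc : ∀ y : Y, UpperSemicontinuous fun x : X => f (x, y))
    (hf_concave : ∀ y : Y, GeodesicConcave fun x : X => f (x, y))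
    (hf_lsc : ∀ x : X, LowerSemicontinuous fun y : Y => f (x, y))
    (hf_convex : ∀ x : X, GeodesicConvex fun y : Y => f (x, y))
    (a : X) (b : Y) :
    ∃! p : X × Y, IsSaddlePoint
      (fun q : X × Y => f q - (1 / 2) * dist q.1 a ^ 2 + (1 / 2) * dist q.2 b ^ 2) p := by
  have : Nonempty X := ⟨a⟩
  have : Nonempty Y := ⟨b⟩
  refine existsUnique_isSaddlePoint (fun y => ?_) (fun y => ?_) (fun x => ?_) (fun x => ?_)
  · convert ((hf_concave y).add_half_sq_dist a).add_const (-((1 / 2) * dist y b ^ 2)) using 2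
    ring
  · have hl : LowerSemicontinuous fun x => -f (x, y) := fun x c hc => by
      filter_upwards [hf_usc y x (-c) (by linarith)] with x' hx'
      linarith
    have e : (fun x => -(f (x, y) - (1 / 2) * dist x a ^ 2 + (1 / 2) * dist y b ^ 2))
        = fun x => (-f (x, y) + (1 / 2) * dist x a ^ 2) + -((1 / 2) * dist y b ^ 2) := by
      funext x
      ring
    exact e ▸ (hl.add_half_sq_dist a).add lowerSemicontinuous_const
  · convert ((hf_convex x).add_half_sq_dist b).add_const (-((1 / 2) * dist x a ^ 2)) using 2
    ring
  · have e : (fun y => f (x, y) - (1 / 2) * dist x a ^ 2 + (1 / 2) * dist y b ^ 2)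
        = fun y => (f (x, y) + (1 / 2) * dist y b ^ 2) + -((1 / 2) * dist x a ^ 2) := by
      funext y
      ring
    exact e ▸ ((hf_lsc x).add_half_sq_dist b).add lowerSemicontinuous_const
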